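/- Let $\mathscr S$ denote the class of compactly generated locally compact groups that are totally disconnected, topologically simple (i.e. non-trivial and with no closed normal subgroup other than the trivial subgroup and the whole group) and non-discrete. Let $G \in \mathscr S$ be such that some open subgroup of $G$ admits a decomposition as a direct product of two non-trivial closed factors. Then $G$ is abstractly simple, i.e. the only normal subgroups of $G$ (closed or not) are the trivial subgroup and $G$ itself. -/

import Mathlib

/-- A topological group is compactly generated if some compact subset generates it as an
abstract group. -/
def IsCompactlyGeneratedGroup (G : Type*) [Group G] [TopologicalSpace G] : Prop :=
  ∃ K : Set G, IsCompact K ∧ Subgroup.closure K = ⊤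

/-- A topological group is topologically simple if it is non-trivial and its only closed normal
subgroups are the trivial subgroup and the whole group. -/
structure IsTopologicallySimpleGroup (G : Type*) [Group G] [TopologicalSpace G] : Prop where
  nontrivial : Nontrivial G
  eq_bot_or_eq_top : ∀ N : Subgroup G, N.Normal → IsClosed (N : Set G) → N = ⊥ ∨ N = ⊤

/-- The class `𝒮`: compactly generated locally compact groups that are totally disconnected,
topologically simple and non-discrete. (A totally disconnected topological group is
automatically Hausdorff.) -/
structure IsInClassS (G : Type*) [Group G] [TopologicalSpace G] [IsTopologicalGroup G] :
    Prop where
  locallyCompact : LocallyCompactSpace G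
  compactlyGenerated : IsCompactlyGeneratedGroup G
  totallyDisconnected : TotallyDisconnectedSpace G
  topologicallySimple : IsTopologicallySimpleGroup G
  nondiscrete : ¬ DiscreteTopology G

/-- The subgroup `O` is the (internal) direct product of its subgroups `A` and `B`: they commute
elementwise, intersect trivially, and generate `O`; equivalently `(a, b) ↦ a * b` is a group
isomorphism from `A × B` onto `O`. -/
structure IsInternalDirectProduct {G : Type*} [Group G] (O A B : Subgroup G) : Prop where
  commute : ∀ a ∈ A, ∀ b ∈ B, a * b = b * a
  inf_eq_bot : A ⊓ B = ⊥
  sup_eq : A ⊔ B = O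

/-- The subgroup `O` admits a decomposition as a direct product of two non-trivial closed
factors. -/
def HasNontrivialClosedDecomposition {G : Type*} [Group G] [TopologicalSpace G]
    (O : Subgroup G) : Prop :=
  ∃ A B : Subgroup G, IsClosed (A : Set G) ∧ IsClosed (B : Set G) ∧ A ≠ ⊥ ∧ B ≠ ⊥ ∧
    IsInternalDirectProduct O A B

/-! Topological simplicity and compact generation force the quasi-centre to be trivial. Local
factors then behave like a Boolean algebra, with meet `⊓` and complement `cent`, on which `G` acts
by conjugation with open stabilizers; a direct decomposition of an open subgroup gives a nontrivial
element.

This algebra has no atoms (`exists_localFactor_lt`), and finitely many nonzero elements suffice for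
every nonzero one to contain a conjugate of one of them (`exists_finite_conj_le`). Hence some `g`
maps some `P` strictly into itself (`exists_conj_lt`).

Let `N` be a nontrivial normal subgroup. It is dense and the stabilizer of `P` is open, so `g` may
be replaced by some `h ∈ N`. The successive differences of the chain `hⁿPh⁻ⁿ` are pairwise disjoint
and shrink to the identity, so small elements of a late one are contracted by `h`. Such elements are
commutators with `h` and lie in `N` (`mem_of_tendsto_conj`). Thus `N` locally contains a nontrivial
local factor; a finite join of such factors is all of `G` (`isLocallyIn_top`), so `N` is open, hence
closed, and being dense is `G`. -/

open Topology Pointwise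

/-! ### The Boolean algebra of local factors. -/

section LocalFactorPairs

variable {G : Type*} [Group G]

/-- The centralizer of a subgroup. -/
abbrev cent (P : Subgroup G) : Subgroup G := Subgroup.centralizer (P : Set G)

/-- The conjugate `g P g⁻¹` of a subgroup. -/
def conjSubgroup (g : G) (P : Subgroup G) : Subgroup G := P.comap (MulAut.conj g⁻¹).toMonoidHom

lemma mem_conjSubgroup {g x : G} {P : Subgroup G} : x ∈ conjSubgroup g P ↔ g⁻¹ * x * g ∈ P := by
  simp [conjSubgroup]

lemma conj_mem_conjSubgroup {g x : G} {P : Subgroup G} (hx : x ∈ P) :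
    g * x * g⁻¹ ∈ conjSubgroup g P := by
  rw [mem_conjSubgroup]; convert hx using 1; group

lemma conjSubgroup_mono {g : G} {P Q : Subgroup G} (h : P ≤ Q) :
    conjSubgroup g P ≤ conjSubgroup g Q := fun _ hx => h hx

lemma conjSubgroup_mul (g h : G) (P : Subgroup G) :
    conjSubgroup (g * h) P = conjSubgroup g (conjSubgroup h P) := by
  ext x; simp only [mem_conjSubgroup, mul_inv_rev, mul_assoc]

@[simp] lemma conjSubgroup_one (P : Subgroup G) : conjSubgroup 1 P = P := by
  ext x; simp [mem_conjSubgroup]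

@[simp] lemma conjSubgroup_bot (g : G) : conjSubgroup g (⊥ : Subgroup G) = ⊥ := by
  ext x
  simp only [mem_conjSubgroup, Subgroup.mem_bot]
  constructor
  · intro h
    have : x = g * (g⁻¹ * x * g) * g⁻¹ := by group
    rw [this, h]; group
  · rintro rfl; group

lemma conjSubgroup_le_iff {g : G} {P Q : Subgroup G} :
    conjSubgroup g P ≤ Q ↔ P ≤ conjSubgroup g⁻¹ Q := by
  constructor
  · intro h
    simpa [← conjSubgroup_mul] using conjSubgroup_mono (g := g⁻¹) h
  · intro h
    simpa [← conjSubgroup_mul] using conjSubgroup_mono (g := g) h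

lemma conjSubgroup_injective (g : G) : Function.Injective (conjSubgroup g) := fun P Q h => by
  simpa [← conjSubgroup_mul] using congrArg (conjSubgroup g⁻¹) h

lemma conjSubgroup_ne_bot {g : G} {P : Subgroup G} (h : P ≠ ⊥) : conjSubgroup g P ≠ ⊥ := fun h' =>
  h (conjSubgroup_injective g (by simpa using h'))

lemma mem_normalizer_iff_conjSubgroup_eq {g : G} {P : Subgroup G} :
    g ∈ Subgroup.normalizer (P : Set G) ↔ conjSubgroup g P = P := by
  rw [Subgroup.mem_normalizer_iff'']
  constructor
  · intro h; ext x; rw [mem_conjSubgroup]; exact (h x).symm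
  · intro h x; rw [← mem_conjSubgroup, h]

lemma normal_of_conjSubgroup_eq {P : Subgroup G} (h : ∀ g, conjSubgroup g P = P) : P.Normal :=
  ⟨fun x hx g => by have := conj_mem_conjSubgroup (g := g) hx; rwa [h g] at this⟩

lemma mem_cent {P : Subgroup G} {x : G} : x ∈ cent P ↔ ∀ p ∈ P, Commute x p := by
  rw [Subgroup.mem_centralizer_iff]
  exact ⟨fun h p hp => (h p hp).symm, fun h p hp => (h p hp).symm⟩

lemma cent_anti {P Q : Subgroup G} (h : P ≤ Q) : cent Q ≤ cent P := Subgroup.centralizer_le h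

lemma le_cent_cent (P : Subgroup G) : P ≤ cent (cent P) := fun _ hx =>
  mem_cent.2 fun _ hy => (mem_cent.1 hy _ hx).symm

lemma le_cent_comm {P Q : Subgroup G} : P ≤ cent Q ↔ Q ≤ cent P := Subgroup.le_centralizer_iff

lemma cent_conjSubgroup (g : G) (P : Subgroup G) :
    cent (conjSubgroup g P) = conjSubgroup g (cent P) := by
  ext x
  rw [mem_cent, mem_conjSubgroup, mem_cent]
  constructor
  · intro h p hp
    have := h _ (conj_mem_conjSubgroup (g := g) hp)
    rw [← Commute.conj_iff g]
    convert this using 1; group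
  · intro h p hp
    have := h (g⁻¹ * p * g) (mem_conjSubgroup.1 hp)
    have e : x = g * (g⁻¹ * x * g) * g⁻¹ := by group
    have e' : p = g * (g⁻¹ * p * g) * g⁻¹ := by group
    rw [e, e', Commute.conj_iff]
    exact this

variable [TopologicalSpace G]

/-- Only the identity centralizes a neighbourhood of the identity. -/
def HasTrivialQuasiCenter (G : Type*) [Group G] [TopologicalSpace G] : Prop :=
  ∀ x : G, ∀ V ∈ 𝓝 (1 : G), (∀ v ∈ V, Commute x v) → x = 1

/-- Two commuting subgroups whose product decomposes a neighbourhood basis of the identity. -/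
structure IsLocalFactorPair (A B : Subgroup G) : Prop where
  commute : ∀ a ∈ A, ∀ b ∈ B, Commute a b
  mul_mem_nhds : ∀ V ∈ 𝓝 (1 : G), ((A : Set G) ∩ V) * ((B : Set G) ∩ V) ∈ 𝓝 (1 : G)

/-- A subgroup that equals its double centralizer and is, locally at the identity, a direct factor
with complement its centralizer. -/
structure IsLocalFactor (P : Subgroup G) : Prop where
  cent_cent : cent (cent P) = P
  mul_mem_nhds : ∀ V ∈ 𝓝 (1 : G), ((P : Set G) ∩ V) * ((cent P : Set G) ∩ V) ∈ 𝓝 (1 : G)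

lemma IsLocalFactorPair.symm {A B : Subgroup G} (h : IsLocalFactorPair A B) :
    IsLocalFactorPair B A where
  commute b hb a ha := (h.commute a ha b hb).symm
  mul_mem_nhds V hV := by
    refine Filter.mem_of_superset (h.mul_mem_nhds V hV) ?_
    rintro _ ⟨a, ha, b, hb, rfl⟩
    exact ⟨b, hb, a, ha, (h.commute a ha.1 b hb.1).symm⟩

lemma IsLocalFactorPair.eq_one {A B : Subgroup G} (hQ : HasTrivialQuasiCenter G)
    (h : IsLocalFactorPair A B) {x : G} {V : Set G} (hV : V ∈ 𝓝 (1 : G))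
    (hA : ∀ a ∈ A, a ∈ V → Commute x a) (hB : ∀ b ∈ B, b ∈ V → Commute x b) : x = 1 := by
  refine hQ x _ (h.mul_mem_nhds V hV) ?_
  rintro _ ⟨a, ha, b, hb, rfl⟩
  exact (hA a ha.1 ha.2).mul_right (hB b hb.1 hb.2)

/-- Near the identity `z = ab`; then `b` centralizes `A` and a neighbourhood in `B`, so it is
quasi-central. -/
lemma IsLocalFactorPair.exists_nhds_mem {A B : Subgroup G} (hQ : HasTrivialQuasiCenter G)
    (h : IsLocalFactorPair A B) {V W : Set G} (hV : V ∈ 𝓝 (1 : G)) (hW : W ∈ 𝓝 (1 : G)) :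
    ∃ N ∈ 𝓝 (1 : G), ∀ z ∈ N, (∀ b ∈ B, b ∈ W → Commute z b) → z ∈ A ∧ z ∈ V := by
  refine ⟨_, h.mul_mem_nhds V hV, ?_⟩
  rintro _ ⟨a, ha, b, hb, rfl⟩ hz
  have : b = 1 := by
    refine h.eq_one hQ hW (fun a' ha' _ => (h.commute a' ha' b hb.1).symm) fun b' hb' hbW => ?_
    have h1 := hz b' hb' hbW
    have h2 := (h.commute a ha.1 b' hb').inv_left
    simpa using h2.mul_left h1
  subst this
  simpa using ha

lemma IsLocalFactor.pair {P : Subgroup G} (h : IsLocalFactor P) :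
    IsLocalFactorPair P (cent P) :=
  ⟨fun a ha _ hb => (mem_cent.1 hb a ha).symm, h.mul_mem_nhds⟩

lemma IsLocalFactor.centralizer {P : Subgroup G} (h : IsLocalFactor P) : IsLocalFactor (cent P) :=
  ⟨by rw [h.cent_cent], by rw [h.cent_cent]; exact h.pair.symm.mul_mem_nhds⟩

lemma IsLocalFactor.eq_one {P : Subgroup G} (hQ : HasTrivialQuasiCenter G)
    (h : IsLocalFactor P) {x : G} (h1 : x ∈ P) (h2 : x ∈ cent P) : x = 1 :=
  h.pair.eq_one hQ Filter.univ_mem (fun a ha _ => mem_cent.1 h2 a ha)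
    fun b hb _ => h.pair.commute x h1 b hb

lemma IsLocalFactor.inf_cent {P : Subgroup G} (hQ : HasTrivialQuasiCenter G)
    (h : IsLocalFactor P) : P ⊓ cent P = ⊥ :=
  (Subgroup.eq_bot_iff_forall _).2 fun _ hx => h.eq_one hQ hx.1 hx.2

lemma IsLocalFactor.eq_bot_of_le_cent {P Q : Subgroup G} (hQ : HasTrivialQuasiCenter G)
    (h : IsLocalFactor Q) (h1 : P ≤ Q) (h2 : P ≤ cent Q) : P = ⊥ :=
  le_bot_iff.1 ((le_inf h1 h2).trans (h.inf_cent hQ).le)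

/-- The elements that centralize some relatively open subgroup of `A`. -/
def quasiCentralizer (A : Subgroup G) : Subgroup G where
  carrier := {x | ∃ V ∈ 𝓝 (1 : G), ∀ a ∈ A, a ∈ V → Commute x a}
  one_mem' := ⟨_, Filter.univ_mem, fun a _ _ => Commute.one_left a⟩
  mul_mem' := by
    rintro x y ⟨V, hV, hx⟩ ⟨W, hW, hy⟩
    exact ⟨_, Filter.inter_mem hV hW, fun a ha haV => (hx a ha haV.1).mul_left (hy a ha haV.2)⟩
  inv_mem' := by
    rintro x ⟨V, hV, hx⟩
    exact ⟨V, hV, fun a ha haV => (hx a ha haV).inv_left⟩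

lemma IsLocalFactorPair.le_quasiCentralizer {A B : Subgroup G} (h : IsLocalFactorPair A B) :
    B ≤ quasiCentralizer A := fun b hb =>
  ⟨_, Filter.univ_mem, fun a ha _ => (h.commute a ha b hb).symm⟩

lemma isLocalFactor_top (hZ : HasTrivialQuasiCenter G) : IsLocalFactor (⊤ : Subgroup G) where
  cent_cent := by
    have : cent (⊤ : Subgroup G) = ⊥ := (Subgroup.eq_bot_iff_forall _).2 fun x hx =>
      hZ x _ Filter.univ_mem fun v _ => mem_cent.1 hx v trivial
    rw [this]
    refine top_le_iff.1 fun x _ => mem_cent.2 fun p hp => ?_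
    rw [Subgroup.mem_bot.1 hp]
    exact Commute.one_right x
  mul_mem_nhds V hV := by
    refine Filter.mem_of_superset hV fun x hx => ⟨x, ⟨trivial, hx⟩, 1, ⟨one_mem _, ?_⟩, mul_one x⟩
    exact mem_of_mem_nhds hV

variable [IsTopologicalGroup G]

lemma conj_preimage_mem_nhds_one (g : G) {V : Set G} (hV : V ∈ 𝓝 (1 : G)) :
    {x | g * x * g⁻¹ ∈ V} ∈ 𝓝 (1 : G) :=
  (IsTopologicalGroup.continuous_conj g).continuousAt.preimage_mem_nhds (by simpa using hV)

lemma IsLocalFactorPair.exists_nhds_conj_mem {A B : Subgroup G} (hQ : HasTrivialQuasiCenter G)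
    (h : IsLocalFactorPair A B) {V : Set G} (hV : V ∈ 𝓝 (1 : G)) {y : G}
    (hy : ∀ b ∈ B, b ∈ V → Commute y b) :
    ∃ N ∈ 𝓝 (1 : G), ∀ a ∈ A, a ∈ N → y⁻¹ * a * y ∈ A ∧ y⁻¹ * a * y ∈ V := by
  obtain ⟨N, hN, hz⟩ := h.exists_nhds_mem hQ hV hV
  refine ⟨_, conj_preimage_mem_nhds_one y⁻¹ hN, fun a ha haN => hz _ (by simpa using haN) ?_⟩
  intro b hb hbV
  rw [← Commute.conj_iff y]
  have : y * b * y⁻¹ = b := by rw [(hy b hb hbV).eq]; group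
  rw [this]
  convert h.commute a ha b hb using 1; group

/-- Conjugation by `y` preserves `A` locally and conjugation by `x` preserves `B` locally, so the
commutator of `x` and `y` centralizes small elements of both and is quasi-central. -/
lemma IsLocalFactorPair.commute_of_quasi {A B : Subgroup G} (hQ : HasTrivialQuasiCenter G)
    (h : IsLocalFactorPair A B) {V : Set G} (hV : V ∈ 𝓝 (1 : G)) {x y : G}
    (hx : ∀ a ∈ A, a ∈ V → Commute x a) (hy : ∀ b ∈ B, b ∈ V → Commute y b) : Commute x y := by
  obtain ⟨N, hN, hA⟩ := h.exists_nhds_conj_mem hQ hV hy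
  obtain ⟨M, hM, hB⟩ := h.symm.exists_nhds_conj_mem hQ hV hx
  have : x * y * x⁻¹ * y⁻¹ = 1 := by
    refine h.eq_one hQ (Filter.inter_mem hV (Filter.inter_mem hN hM)) ?_ ?_
    · rintro a ha ⟨haV, haN, -⟩
      rw [show x * y * x⁻¹ * y⁻¹ = x * (y * x⁻¹ * y⁻¹) by group]
      have h1 : Commute (y * x⁻¹ * y⁻¹) a := by
        have := (hx _ (hA a ha haN).1 (hA a ha haN).2).inv_left
        rw [← Commute.conj_iff y] at this
        simpa [mul_assoc] using this
      exact (hx a ha haV).mul_left h1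
    · rintro b hb ⟨hbV, -, hbM⟩
      have h1 : Commute (x * y * x⁻¹) b := by
        have := hy _ (hB b hb hbM).1 (hB b hb hbM).2
        rw [← Commute.conj_iff x] at this
        simpa [mul_assoc] using this
      exact h1.mul_left (hy b hb hbV).inv_left
  have h2 : x * y = (x * y * x⁻¹ * y⁻¹) * (y * x) := by group
  rw [this, one_mul] at h2
  exact h2

lemma IsLocalFactor.mem_cent_of_quasi {P : Subgroup G} (hQ : HasTrivialQuasiCenter G)
    (h : IsLocalFactor P) {V : Set G} (hV : V ∈ 𝓝 (1 : G)) {x : G}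
    (hx : ∀ a ∈ P, a ∈ V → Commute x a) : x ∈ cent P :=
  mem_cent.2 fun p hp => h.pair.commute_of_quasi hQ hV hx fun b hb _ => h.pair.commute p hp b hb

lemma IsLocalFactor.inf {P Q : Subgroup G} (hZ : HasTrivialQuasiCenter G)
    (hP : IsLocalFactor P) (hQ : IsLocalFactor Q) : IsLocalFactor (P ⊓ Q) where
  cent_cent := by
    refine le_antisymm (le_inf ?_ ?_) (le_cent_cent _)
    · exact (cent_anti (cent_anti inf_le_left)).trans hP.cent_cent.le
    · exact (cent_anti (cent_anti inf_le_right)).trans hQ.cent_cent.le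
  mul_mem_nhds V hV := by
    obtain ⟨W, hWo, hW1, hWV⟩ := exists_open_nhds_one_mul_subset hV
    have hW := hWo.mem_nhds hW1
    have hM := hQ.mul_mem_nhds (W ∩ V) (Filter.inter_mem hW hV)
    refine Filter.mem_of_superset (hP.mul_mem_nhds _ (Filter.inter_mem hM hW)) ?_
    rintro _ ⟨p, ⟨hp, ⟨q, ⟨hq, hqW⟩, q', ⟨hq', hqW'⟩, rfl⟩, -⟩, p', ⟨hp', -, hpW'⟩, rfl⟩
    -- The `Q`-component of an element of `P` stays in `P = cent (cent P)`: if `r * r'` centralizes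
    -- `P`, comparing components in `Q` and `cent Q` shows that `q` commutes with `r`.
    have hqP : q ∈ P := by
      rw [← hP.cent_cent]
      refine hP.centralizer.mem_cent_of_quasi hZ hM ?_
      rintro _ hy ⟨r, ⟨hr, -⟩, r', ⟨hr', -⟩, rfl⟩
      have h1 : (q * q') * (r * r') = (r * r') * (q * q') := mem_cent.1 hy _ hp |>.symm
      have h2 := (hQ.pair.commute q hq r' hr').eq
      have h3 := (hQ.pair.commute r hr q' hq').eq
      have h4 : q * r * (q' * r') = r * q * (r' * q') := by
        calc q * r * (q' * r') = q * (r * q') * r' := by group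
          _ = (q * q') * (r * r') := by rw [h3]; group
          _ = r * (r' * q) * q' := by rw [h1]; group
          _ = r * q * (r' * q') := by rw [← h2]; group
      have h5 : (r * q)⁻¹ * (q * r) = (r' * q') * (q' * r')⁻¹ := by
        rw [inv_mul_eq_iff_eq_mul, ← mul_assoc, eq_mul_inv_iff_mul_eq, h4]
      have h6 : (r * q)⁻¹ * (q * r) = 1 := by
        refine hQ.eq_one hZ (Q.mul_mem (Q.inv_mem (Q.mul_mem hr hq)) (Q.mul_mem hq hr)) ?_
        rw [h5]
        exact mul_mem (mul_mem hr' hq') (inv_mem (mul_mem hq' hr'))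
      have h7 : Commute q r := (inv_mul_eq_one.1 h6).symm
      exact h7.mul_right h2
    refine ⟨q, ⟨⟨hqP, hq⟩, hqW.2⟩, q' * p', ⟨?_, hWV (Set.mul_mem_mul hqW'.1 hpW')⟩, ?_⟩
    · exact mul_mem (cent_anti inf_le_right hq') (cent_anti inf_le_left hp')
    · simp [mul_assoc]

lemma IsLocalFactor.conj {P : Subgroup G} (h : IsLocalFactor P) (g : G) :
    IsLocalFactor (conjSubgroup g P) where
  cent_cent := by rw [cent_conjSubgroup, cent_conjSubgroup, h.cent_cent]
  mul_mem_nhds V hV := by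
    rw [cent_conjSubgroup]
    have h1 := h.mul_mem_nhds _ (conj_preimage_mem_nhds_one g hV)
    refine Filter.mem_of_superset (conj_preimage_mem_nhds_one g⁻¹ h1) ?_
    rintro x ⟨a, ⟨ha, haV⟩, b, ⟨hb, hbV⟩, hx⟩
    refine ⟨_, ⟨conj_mem_conjSubgroup ha, haV⟩, _, ⟨conj_mem_conjSubgroup hb, hbV⟩, ?_⟩
    have : x = g * (a * b) * g⁻¹ := by
      simp only at hx
      rw [hx]; group
    rw [this]; simp only; group

lemma IsLocalFactor.isOpen_normalizer {P : Subgroup G} (h : IsLocalFactor P) :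
    IsOpen (Subgroup.normalizer (P : Set G) : Set G) := by
  refine Subgroup.isOpen_of_mem_nhds _
    (Filter.mem_of_superset (h.mul_mem_nhds _ Filter.univ_mem) ?_)
  rintro _ ⟨a, ⟨ha, -⟩, b, ⟨hb, -⟩, rfl⟩
  exact mul_mem (Subgroup.le_normalizer ha) (Subgroup.centralizer_le_normalizer _ hb)

/-- Normalizers are open, and commutators of elements of `P` and `Q` normalizing the other factor
lie in `P ⊓ Q`. Local commutation then becomes global by `mem_cent_of_quasi`. -/
lemma IsLocalFactor.le_cent_of_inf_eq_bot {P Q : Subgroup G} (hZ : HasTrivialQuasiCenter G)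
    (hP : IsLocalFactor P) (hQ : IsLocalFactor Q) (h : P ⊓ Q = ⊥) : P ≤ cent Q := by
  have hVP := hP.isOpen_normalizer.mem_nhds (one_mem _)
  have hVQ := hQ.isOpen_normalizer.mem_nhds (one_mem _)
  have key : ∀ x ∈ P, x ∈ Subgroup.normalizer (Q : Set G) → x ∈ cent Q := by
    intro x hx hxQ
    refine hQ.mem_cent_of_quasi hZ hVP fun y hy hyP => ?_
    have h1 : x * y * x⁻¹ * y⁻¹ ∈ P ⊓ Q := by
      refine Subgroup.mem_inf.2 ⟨?_, ?_⟩
      · have := (Subgroup.mem_normalizer_iff.1 hyP x⁻¹).1 (inv_mem hx)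
        have := mul_mem hx this
        convert this using 1; group
      · exact mul_mem ((Subgroup.mem_normalizer_iff.1 hxQ y).1 hy) (inv_mem hy)
    rw [h, Subgroup.mem_bot] at h1
    have h2 : x * y = (x * y * x⁻¹ * y⁻¹) * (y * x) := by group
    rw [h1, one_mul] at h2
    exact h2
  rw [le_cent_comm]
  intro y hy
  exact hP.mem_cent_of_quasi hZ hVQ fun x hx hxQ => (mem_cent.1 (key x hx hxQ) y hy).symm

lemma IsLocalFactor.le_of_inf_cent_eq_bot {P Q : Subgroup G} (hZ : HasTrivialQuasiCenter G)
    (hP : IsLocalFactor P) (hQ : IsLocalFactor Q) (h : P ⊓ cent Q = ⊥) : P ≤ Q :=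
  (hP.le_cent_of_inf_eq_bot hZ hQ.centralizer h).trans hQ.cent_cent.le

lemma IsLocalFactorPair.cent_quasiCentralizer {A B : Subgroup G} (hZ : HasTrivialQuasiCenter G)
    (h : IsLocalFactorPair A B) : cent (quasiCentralizer A) = quasiCentralizer B := by
  refine le_antisymm (?_) ?_
  · refine fun x hx => ⟨_, Filter.univ_mem, fun b hb _ => ?_⟩
    exact mem_cent.1 hx b ⟨_, Filter.univ_mem, fun a ha _ => (h.commute a ha b hb).symm⟩
  · rintro y ⟨V, hV, hy⟩
    refine mem_cent.2 ?_
    rintro x ⟨W, hW, hx⟩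
    exact (h.commute_of_quasi hZ (Filter.inter_mem hV hW) (fun a ha haV => hx a ha haV.2)
      fun b hb hbV => hy b hb hbV.1).symm

/-- The quasi-centralizers of `A` and `B` are each other's centralizers, so they complete any local
decomposition to one by local factors. -/
lemma IsLocalFactorPair.isLocalFactor {A B : Subgroup G} (hZ : HasTrivialQuasiCenter G)
    (h : IsLocalFactorPair A B) : IsLocalFactor (quasiCentralizer A) where
  cent_cent := by rw [h.cent_quasiCentralizer hZ, h.symm.cent_quasiCentralizer hZ]
  mul_mem_nhds V hV := by
    rw [h.cent_quasiCentralizer hZ]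
    exact Filter.mem_of_superset (h.symm.mul_mem_nhds V hV)
      (Set.mul_subset_mul (Set.inter_subset_inter_left _ h.le_quasiCentralizer)
        (Set.inter_subset_inter_left _ h.symm.le_quasiCentralizer))

end LocalFactorPairs

lemma Subgroup.normal_of_closure_eq_top {G : Type*} [Group G] (W : Subgroup G) {S : Set G} (hS : Subgroup.closure S = ⊤)
    (h : S ⊆ Subgroup.normalizer (W : Set G)) : W.Normal := by
  rw [← Subgroup.normalizer_eq_top_iff, ← top_le_iff, ← hS, Subgroup.closure_le]
  exact h

/-! ### Totally disconnected, compactly generated and topologically simple groups. -/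

section TotallyDisconnected

variable {G : Type*} [Group G] [TopologicalSpace G] [IsTopologicalGroup G]

/-- **Van Dantzig's theorem**. -/
theorem exists_compact_open_subgroup [T2Space G] [LocallyCompactSpace G]
    [TotallyDisconnectedSpace G] {V : Set G} (hV : V ∈ 𝓝 (1 : G)) :
    ∃ U : Subgroup G, IsOpen (U : Set G) ∧ IsCompact (U : Set G) ∧ (U : Set G) ⊆ V := by
  obtain ⟨C, hC, hCV, hCc⟩ := local_compact_nhds hV
  obtain ⟨K, hK, h1K, hKC⟩ := (loc_compact_Haus_tot_disc_of_zero_dim (H := G)).mem_nhds_iff.1 hC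
  have hKcl : IsClopen K := hK
  have hKc : IsCompact K := hCc.of_isClosed_subset hKcl.1 hKC
  obtain ⟨T, hT, hKT⟩ := compact_open_separated_mul_right hKc hKcl.2 subset_rfl
  let U : Subgroup G :=
    { carrier := {x | ∀ k, k ∈ K ↔ k * x ∈ K}
      one_mem' := by simp
      mul_mem' := by
        intro x y hx hy k
        rw [hx, hy, mul_assoc]
      inv_mem' := by
        intro x hx k
        rw [hx (k * x⁻¹)]; simp }
  have hUK : (U : Set G) ⊆ K := fun x hx => by simpa using (hx 1).1 h1K
  have hUo : IsOpen (U : Set G) := by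
    refine Subgroup.isOpen_of_mem_nhds (g := 1) U
      (Filter.mem_of_superset (Filter.inter_mem hT (inv_mem_nhds_one G hT)) ?_)
    rintro x ⟨hx, hx'⟩ k
    refine ⟨fun hk => hKT (Set.mul_mem_mul hk hx), fun hk => ?_⟩
    have := hKT (Set.mul_mem_mul hk hx')
    simpa using this
  exact ⟨U, hUo, hKc.of_isClosed_subset (Subgroup.isClosed_of_isOpen U hUo) hUK,
    hUK.trans (hKC.trans hCV)⟩

theorem exists_open_normalized_subgroup [TotallyDisconnectedSpace G]
    {U : Subgroup G} (hUo : IsOpen (U : Set G)) (hUc : IsCompact (U : Set G)) {V : Set G}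
    (hV : V ∈ 𝓝 (1 : G)) :
    ∃ W : Subgroup G, IsOpen (W : Set G) ∧ W ≤ U ∧ (W : Set G) ⊆ V ∧
      U ≤ Subgroup.normalizer (W : Set G) := by
  have : CompactSpace U := isCompact_iff_compactSpace.1 hUc
  obtain ⟨V', hV', hV'o, h1⟩ := mem_nhds_iff.1 hV
  obtain ⟨H, hH⟩ := ProfiniteGrp.exist_openNormalSubgroup_sub_open_nhds_of_one
    (G := U) (hV'o.preimage continuous_subtype_val) (by simpa using h1)
  refine ⟨H.toSubgroup.map U.subtype, ?_, Subgroup.map_subtype_le _, ?_, ?_⟩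
  · exact hUo.isOpenMap_subtype_val _ H.isOpen'
  · rintro _ ⟨x, hx, rfl⟩
    exact hV' (hH hx)
  · intro u hu
    rw [Subgroup.mem_normalizer_iff]
    have key : ∀ u ∈ U, ∀ h, h ∈ H.toSubgroup.map U.subtype →
        u * h * u⁻¹ ∈ H.toSubgroup.map U.subtype := by
      rintro u hu _ ⟨x, hx, rfl⟩
      exact ⟨⟨u, hu⟩ * x * ⟨u, hu⟩⁻¹, H.isNormal'.conj_mem x hx _, rfl⟩
    refine fun h => ⟨key u hu h, fun hh => ?_⟩
    have := key u⁻¹ (inv_mem hu) _ hh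
    convert this using 1; group

lemma IsTopologicallySimpleGroup.dense (hS : IsTopologicallySimpleGroup G)
    {N : Subgroup G} (hN : N.Normal) (h : N ≠ ⊥) : Dense (N : Set G) := by
  have := Subgroup.is_normal_topologicalClosure N
  rcases hS.eq_bot_or_eq_top _ this N.isClosed_topologicalClosure with h1 | h1
  · exact (h (le_bot_iff.1 (N.le_topologicalClosure.trans h1.le))).elim
  · rw [dense_iff_closure_eq, ← Subgroup.topologicalClosure_coe, h1, Subgroup.coe_top]

lemma IsTopologicallySimpleGroup.eq_top_of_isOpen (hS : IsTopologicallySimpleGroup G)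
    {N H : Subgroup G} (hN : N.Normal) (h : N ≠ ⊥) (hNH : N ≤ H) (hH : IsOpen (H : Set G)) :
    H = ⊤ := by
  have h1 := (hS.dense hN h).mono hNH
  have h2 := (Subgroup.isClosed_of_isOpen H hH).closure_eq
  rw [h1.closure_eq] at h2
  exact SetLike.coe_injective h2.symm

/-- Cosets `dU` with `d ∈ D` cover `G` by density, and finitely many cover a compact generating set.
-/
theorem exists_finite_generate_of_dense (hG : IsCompactlyGeneratedGroup G) {D : Set G}
    (hD : Dense D) {U : Subgroup G} (hU : IsOpen (U : Set G)) :
    ∃ F : Set G, F.Finite ∧ F ⊆ D ∧ Subgroup.closure ((U : Set G) ∪ F) = ⊤ := by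
  obtain ⟨K, hK, hKt⟩ := hG
  obtain ⟨F, hF, hFf, hKF⟩ := hK.elim_finite_subcover_image (b := D)
    (c := fun d => (fun x => d⁻¹ * x) ⁻¹' (U : Set G))
    (fun d _ => hU.preimage (continuous_const_mul _)) (by
      intro k _
      obtain ⟨d, hd, hdD⟩ := hD.inter_open_nonempty ((fun d => d⁻¹ * k) ⁻¹' (U : Set G))
        (hU.preimage (by fun_prop)) ⟨k, by simp⟩
      exact Set.mem_biUnion hdD hd)
  refine ⟨F, hFf, hF, top_le_iff.1 ?_⟩
  rw [← hKt, Subgroup.closure_le]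
  intro k hk
  obtain ⟨d, hd, hdk⟩ := Set.mem_iUnion₂.1 (hKF hk)
  have h1 := mul_mem (Subgroup.subset_closure (Set.mem_union_right (U : Set G) hd))
    (Subgroup.subset_closure (Set.mem_union_left F hdk))
  simpa using h1

lemma isSigmaCompact_of_compactlyGenerated (hG : IsCompactlyGeneratedGroup G) :
    SigmaCompactSpace G := by
  obtain ⟨K, hK, hKt⟩ := hG
  have hS : IsCompact (K ∪ K⁻¹) := hK.union hK.inv
  rw [← isSigmaCompact_univ_iff]
  have : (Set.univ : Set G) = ⋃ n : ℕ, (K ∪ K⁻¹) ^ n := by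
    symm
    rw [Set.eq_univ_iff_forall]
    intro x
    have hx : x ∈ Subgroup.closure K := hKt ▸ Subgroup.mem_top x
    rw [← Subgroup.mem_toSubmonoid, Subgroup.closure_toSubmonoid] at hx
    induction hx using Submonoid.closure_induction with
    | mem x hx => exact Set.mem_iUnion.2 ⟨1, by simpa using hx⟩
    | one => exact Set.mem_iUnion.2 ⟨0, by simp⟩
    | mul x y _ _ hx hy =>
      obtain ⟨n, hn⟩ := Set.mem_iUnion.1 hx
      obtain ⟨m, hm⟩ := Set.mem_iUnion.1 hy
      exact Set.mem_iUnion.2 ⟨n + m, by rw [pow_add]; exact Set.mul_mem_mul hn hm⟩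
  rw [this]
  refine isSigmaCompact_iUnion_of_isCompact _ fun n => ?_
  induction n with
  | zero => simp
  | succ n ih => rw [pow_succ]; exact ih.mul hS

/-- Multiplication `A × B → O` is a continuous surjection from a σ-compact group, hence open by the
open mapping theorem. -/
theorem IsInternalDirectProduct.isLocalFactorPair [T2Space G] [LocallyCompactSpace G]
    [SigmaCompactSpace G] {O A B : Subgroup G} (h : IsInternalDirectProduct O A B)
    (hO : IsOpen (O : Set G)) (hA : IsClosed (A : Set G)) (hB : IsClosed (B : Set G)) :
    IsLocalFactorPair A B where
  commute := h.commute
  mul_mem_nhds V hV := by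
    have : SigmaCompactSpace A := hA.isClosedEmbedding_subtypeVal.sigmaCompactSpace
    have : SigmaCompactSpace B := hB.isClosedEmbedding_subtypeVal.sigmaCompactSpace
    have : LocallyCompactSpace O := hO.locallyCompactSpace
    let f : A × B →* G := A.subtype.noncommCoprod B.subtype fun a b => h.commute a a.2 b b.2
    have hr : f.range = O := (MonoidHom.noncommCoprod_range _ _ _).trans (by simp [h.sup_eq])
    let F : A × B →* O := f.codRestrict O fun x => hr ▸ ⟨x, rfl⟩
    have hF : Function.Surjective F := by
      rintro ⟨x, hx⟩
      rw [← hr] at hx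
      obtain ⟨y, rfl⟩ := hx
      exact ⟨y, rfl⟩
    have hFc : Continuous F := by
      refine Continuous.subtype_mk ?_ _
      exact (continuous_subtype_val.comp continuous_fst).mul
        (continuous_subtype_val.comp continuous_snd)
    have hFo := MonoidHom.isOpenMap_of_sigmaCompact F hF hFc
    have h1 := (hO.isOpenMap_subtype_val.comp hFo).image_mem_nhds
      (x := (1 : A × B)) (s := {p | (p.1 : G) ∈ V ∧ (p.2 : G) ∈ V}) (by
        refine Filter.inter_mem ?_ ?_
        · exact (continuous_subtype_val.comp continuous_fst).continuousAt.preimage_mem_nhds hV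
        · exact (continuous_subtype_val.comp continuous_snd).continuousAt.preimage_mem_nhds hV)
    have h2 : (Subtype.val ∘ F) (1 : A × B) = 1 := by simp
    replace h1 := h2 ▸ h1
    refine Filter.mem_of_superset h1 ?_
    rintro _ ⟨⟨a, b⟩, ⟨ha, hb⟩, rfl⟩
    exact ⟨a, ⟨a.2, ha⟩, b, ⟨b.2, hb⟩, rfl⟩

end TotallyDisconnected

/-! ### Noncompactness and the trivial quasi-centre. -/

namespace IsInClassS

variable {G : Type*} [Group G] [TopologicalSpace G] [IsTopologicalGroup G]

lemma t2Space (hG : IsInClassS G) : T2Space G := by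
  have := hG.totallyDisconnected
  have : T1Space G := inferInstance
  infer_instance

lemma not_compactSpace (hG : IsInClassS G) : ¬ CompactSpace G := by
  intro hc
  have := hG.totallyDisconnected
  have := hG.t2Space
  have := hG.topologicallySimple.nontrivial
  obtain ⟨x, hx⟩ := exists_ne (1 : G)
  obtain ⟨H, hH⟩ := ProfiniteGrp.exist_openNormalSubgroup_sub_open_nhds_of_one
    (G := G) (isOpen_compl_singleton (x := x)) (by simpa using hx.symm)
  have hHo : IsOpen (H.toSubgroup : Set G) := H.isOpen'
  rcases hG.topologicallySimple.eq_bot_or_eq_top H.toSubgroup H.isNormal'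
    (Subgroup.isClosed_of_isOpen _ hHo) with h | h
  · rw [h, Subgroup.coe_bot] at hHo
    exact hG.nondiscrete (discreteTopology_of_isOpen_singleton_one hHo)
  · have h1 : x ∈ H.toSubgroup := h ▸ Subgroup.mem_top x
    exact hH h1 rfl

lemma eq_bot_of_normal_of_le (hG : IsInClassS G) {W : Subgroup G} (hW : W.Normal)
    (hWc : IsClosed (W : Set G)) {U : Set G} (hU : IsCompact U) (hWU : (W : Set G) ⊆ U) :
    W = ⊥ := by
  refine (hG.topologicallySimple.eq_bot_or_eq_top W hW hWc).resolve_right fun h => ?_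
  refine hG.not_compactSpace ⟨?_⟩
  rw [h, Subgroup.coe_top, Set.univ_subset_iff] at hWU
  exact hWU ▸ hU

/-- A nontrivial quasi-centre would be dense, so a compact open `U` and finitely many quasi-central
elements would generate `G`. A small open subgroup normalized by `U` and centralized by those
elements would be normal inside a compact set, hence trivial, making `G` discrete. -/
theorem hasTrivialQuasiCenter (hG : IsInClassS G) : HasTrivialQuasiCenter G := by
  have := hG.totallyDisconnected
  have := hG.locallyCompact
  have := hG.t2Space
  intro x V hV hx
  by_contra hx1
  have hN : (quasiCentralizer (⊤ : Subgroup G)).Normal := by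
    refine ⟨?_⟩
    rintro y ⟨W, hW, hy⟩ g
    refine ⟨_, conj_preimage_mem_nhds_one g⁻¹ hW, fun a _ ha => ?_⟩
    rw [← Commute.conj_iff g⁻¹]
    convert hy (g⁻¹ * a * g⁻¹⁻¹) trivial ha using 1; group
  have hD := hG.topologicallySimple.dense hN fun h => hx1 <| by
    rw [← Subgroup.mem_bot, ← h]
    exact ⟨V, hV, fun a _ ha => hx a ha⟩
  obtain ⟨U, hUo, hUc, -⟩ := exists_compact_open_subgroup (G := G) Filter.univ_mem
  obtain ⟨F, hFf, hFD, hF⟩ := exists_finite_generate_of_dense hG.compactlyGenerated hD hUo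
  choose! v hv hvF using hFD
  obtain ⟨W, hWo, hWU, hWV, hWn⟩ := exists_open_normalized_subgroup hUo hUc
    ((Filter.biInter_mem hFf).2 hv)
  have hWN : W.Normal := by
    refine Subgroup.normal_of_closure_eq_top W hF (Set.union_subset hWn fun f hf => ?_)
    refine Subgroup.centralizer_le_normalizer _ (mem_cent.2 fun w hw => ?_)
    exact hvF hf w trivial (Set.mem_iInter₂.1 (hWV hw) f hf)
  have hb := hG.eq_bot_of_normal_of_le hWN (Subgroup.isClosed_of_isOpen W hWo) hUc hWU
  rw [hb, Subgroup.coe_bot] at hWo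
  exact hG.nondiscrete (discreteTopology_of_isOpen_singleton_one hWo)

end IsInClassS

/-! ### Nontrivial local factors. -/

section LocalFactors

variable {G : Type*} [Group G] [TopologicalSpace G]

lemma IsLocalFactor.isClosed [IsTopologicalGroup G] [T2Space G] {P : Subgroup G}
    (h : IsLocalFactor P) : IsClosed (P : Set G) := by
  rw [← h.cent_cent]
  exact Set.isClosed_centralizer _

variable [IsTopologicalGroup G]

/-- The group has a local factor that is neither trivial nor everything. -/
def HasNontrivialLocalFactor (G : Type*) [Group G] [TopologicalSpace G] : Prop :=
  ∃ P : Subgroup G, IsLocalFactor P ∧ P ≠ ⊥ ∧ cent P ≠ ⊥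

/-- An element of `P ⊓ cent Q` is fixed by `u`, so it also lies in `cent P` and is trivial. -/
lemma IsLocalFactor.le_of_conj_le_cent {P Q : Subgroup G} (hZ : HasTrivialQuasiCenter G)
    (hP : IsLocalFactor P) (hQ : IsLocalFactor Q) {u : G} (hu : u ∈ Q)
    (h : conjSubgroup u P ≤ cent P) : P ≤ Q := by
  refine hP.le_of_inf_cent_eq_bot hZ hQ (hP.eq_bot_of_le_cent hZ inf_le_left ?_)
  intro x hx
  have h1 : x = u * x * u⁻¹ := by rw [(mem_cent.1 hx.2 u hu).symm.eq]; group
  exact h (h1 ▸ conj_mem_conjSubgroup hx.1)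

lemma IsLocalFactor.inf_ne_bot_of_mem_nhds {P : Subgroup G} (hZ : HasTrivialQuasiCenter G)
    (hP : IsLocalFactor P) (hb : P ≠ ⊥) {V : Set G} (hV : V ∈ 𝓝 (1 : G)) :
    ∃ x ∈ P, x ∈ V ∧ x ≠ 1 := by
  by_contra! h
  refine hb (hP.eq_bot_of_le_cent hZ le_rfl fun x _ => ?_)
  refine hP.mem_cent_of_quasi hZ hV fun a ha haV => ?_
  rw [h a ha haV]
  exact Commute.one_right x

theorem IsLocalFactorPair.hasNontrivialLocalFactor {A B : Subgroup G}
    (hZ : HasTrivialQuasiCenter G) (h : IsLocalFactorPair A B) (hA : A ≠ ⊥) (hB : B ≠ ⊥) :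
    HasNontrivialLocalFactor G := by
  refine ⟨_, h.isLocalFactor hZ, fun h1 => hB ?_, fun h1 => hA ?_⟩
  · exact le_bot_iff.1 (h.le_quasiCentralizer.trans h1.le)
  · rw [h.cent_quasiCentralizer hZ] at h1
    exact le_bot_iff.1 (h.symm.le_quasiCentralizer.trans h1.le)

end LocalFactors

/-! ### Dynamics of conjugation on local factors. -/

namespace IsInClassS

variable {G : Type*} [Group G] [TopologicalSpace G] [IsTopologicalGroup G]

lemma eq_top_of_conjSubgroup_eq (hG : IsInClassS G) {P : Subgroup G} (hP : IsLocalFactor P)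
    (hb : P ≠ ⊥) (h : ∀ g, conjSubgroup g P = P) : P = ⊤ := by
  have := hG.t2Space
  exact (hG.topologicallySimple.eq_bot_or_eq_top P (normal_of_conjSubgroup_eq h)
    hP.isClosed).resolve_left hb

lemma exists_conjSubgroup_ne (hG : IsInClassS G) {P : Subgroup G} (hP : IsLocalFactor P)
    (hb : P ≠ ⊥) (hc : cent P ≠ ⊥) : ∃ g, conjSubgroup g P ≠ P := by
  by_contra! h
  refine hc (hP.centralizer.eq_bot_of_le_cent hG.hasTrivialQuasiCenter le_rfl ?_)
  rw [hP.cent_cent, hG.eq_top_of_conjSubgroup_eq hP hb h]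
  exact le_top

/-- Each conjugate of an atom `P` equals `P` or meets it trivially, hence commutes with it. So the
normal closure of `P`, which is dense, lies in the open normalizer of `P`, and `P` would be normal.
-/
theorem exists_localFactor_lt (hG : IsInClassS G) (h0 : HasNontrivialLocalFactor G)
    {P : Subgroup G} (hP : IsLocalFactor P) (hb : P ≠ ⊥) :
    ∃ Q, IsLocalFactor Q ∧ Q ≠ ⊥ ∧ Q < P := by
  have hZ := hG.hasTrivialQuasiCenter
  by_contra! hmin
  have hdich : ∀ Q, IsLocalFactor Q → P ⊓ Q = ⊥ ∨ P ≤ Q := by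
    intro Q hQ
    by_contra! h
    exact hmin _ (hP.inf hZ hQ) h.1 (lt_of_le_of_ne inf_le_left fun h' => h.2 (inf_eq_left.1 h'))
  have hc : cent P ≠ ⊥ := by
    intro hc
    obtain ⟨R, hR, hRb, hRc⟩ := h0
    have hP1 : ∀ Q : Subgroup G, Q ≤ P := by
      intro Q
      rw [← hP.cent_cent, hc]
      refine fun x _ => mem_cent.2 fun p hp => ?_
      rw [Subgroup.mem_bot.1 hp]
      exact Commute.one_right x
    rcases hdich R hR with h | h
    · exact hRb (by rwa [inf_eq_right.2 (hP1 R)] at h)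
    · exact hRc (hR.centralizer.eq_bot_of_le_cent hZ le_rfl
        (((hP1 _).trans h).trans (le_cent_cent R)))
  obtain ⟨g, hg⟩ := hG.exists_conjSubgroup_ne hP hb hc
  refine hg (mem_normalizer_iff_conjSubgroup_eq.1 ?_)
  have hle : Subgroup.normalClosure (P : Set G) ≤ Subgroup.normalizer (P : Set G) := by
    rw [Subgroup.normalClosure, Subgroup.closure_le]
    intro x hx
    obtain ⟨p, hp, hpx⟩ := Group.mem_conjugatesOfSet_iff.1 hx
    obtain ⟨c, rfl⟩ := isConj_iff.1 hpx
    have hx' : c * p * c⁻¹ ∈ conjSubgroup c P := conj_mem_conjSubgroup hp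
    rcases hdich _ (hP.conj c) with h | h
    · have := (hP.conj c).le_cent_of_inf_eq_bot hZ hP (by rwa [inf_comm])
      exact Subgroup.centralizer_le_normalizer _ (this hx')
    · have hle : conjSubgroup c⁻¹ P ≤ P := by rwa [conjSubgroup_le_iff, inv_inv]
      have heq : conjSubgroup c⁻¹ P = P := by
        by_contra hne
        exact hmin _ (hP.conj c⁻¹) (conjSubgroup_ne_bot hb) (lt_of_le_of_ne hle hne)
      have heq' : conjSubgroup c P = P := by
        conv_lhs => rw [← heq, ← conjSubgroup_mul]
        simp
      exact Subgroup.le_normalizer (heq' ▸ hx')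
  have := hG.topologicallySimple.eq_top_of_isOpen (Subgroup.normalClosure_normal (s := (P : Set G)))
    (fun h => hb (le_bot_iff.1 (Subgroup.subset_normalClosure.trans h.le))) hle hP.isOpen_normalizer
  exact this ▸ Subgroup.mem_top g

/-- The action is faithful: its kernel is normal and lies in proper open normalizers. If `u` moves
`P`, then one of the differences between `P` and its conjugate is nontrivial and is displaced off
itself by `u`. -/
theorem exists_localFactor_conj_le_cent (hG : IsInClassS G) (h0 : HasNontrivialLocalFactor G)
    {u : G} (hu : u ≠ 1) :
    ∃ P, IsLocalFactor P ∧ P ≠ ⊥ ∧ conjSubgroup u P ≤ cent P := by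
  have hZ := hG.hasTrivialQuasiCenter
  have hmove : ∃ P, IsLocalFactor P ∧ conjSubgroup u P ≠ P := by
    by_contra! h
    let K : Subgroup G := ⨅ (P : Subgroup G) (_ : IsLocalFactor P), Subgroup.normalizer (P : Set G)
    have hK : ∀ x, x ∈ K ↔ ∀ P, IsLocalFactor P → conjSubgroup x P = P := by
      intro x
      simp only [K, Subgroup.mem_iInf, mem_normalizer_iff_conjSubgroup_eq]
    have hKn : K.Normal := by
      refine ⟨fun x hx g => ?_⟩
      rw [hK] at hx ⊢
      intro P hP
      rw [conjSubgroup_mul, conjSubgroup_mul, hx _ (hP.conj g⁻¹), ← conjSubgroup_mul]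
      simp
    obtain ⟨R, hR, hRb, hRc⟩ := h0
    obtain ⟨g, hg⟩ := hG.exists_conjSubgroup_ne hR hRb hRc
    have hKb : K ≠ ⊥ := fun hKb => hu (by
      rw [← Subgroup.mem_bot, ← hKb, hK]; exact h)
    have := hG.topologicallySimple.eq_top_of_isOpen hKn hKb (iInf₂_le R hR) hR.isOpen_normalizer
    exact hg (mem_normalizer_iff_conjSubgroup_eq.1 (this ▸ Subgroup.mem_top g))
  obtain ⟨P, hP, hPu⟩ := hmove
  have hPc := hP.conj u
  by_cases h1 : P ⊓ cent (conjSubgroup u P) = ⊥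
  · have hle := hP.le_of_inf_cent_eq_bot hZ hPc h1
    refine ⟨conjSubgroup u P ⊓ cent P, hPc.inf hZ hP.centralizer, fun h2 => hPu ?_, ?_⟩
    · exact le_antisymm (hPc.le_of_inf_cent_eq_bot hZ hP h2) hle
    · refine (conjSubgroup_mono inf_le_right).trans ?_
      rw [← cent_conjSubgroup]
      exact cent_anti inf_le_left
  · refine ⟨P ⊓ cent (conjSubgroup u P), hP.inf hZ hPc.centralizer, h1, ?_⟩
    refine (conjSubgroup_mono inf_le_left).trans ((le_cent_cent _).trans (cent_anti inf_le_right))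

/-- Over a compact set avoiding the identity, finitely many local factors witness that every
element acts nontrivially. -/
theorem exists_finite_localFactors (hG : IsInClassS G) (h0 : HasNontrivialLocalFactor G)
    {C : Set G} (hC : IsCompact C) (h1 : (1 : G) ∉ C) :
    ∃ S : Set (Subgroup G), S.Finite ∧ (∀ P ∈ S, IsLocalFactor P ∧ P ≠ ⊥) ∧
      ∀ Q, IsLocalFactor Q → ∀ u ∈ Q, u ∈ C → ∃ P ∈ S, P ≤ Q := by
  have hZ := hG.hasTrivialQuasiCenter
  have : ∀ u : G, u ∈ C → ∃ P, IsLocalFactor P ∧ P ≠ ⊥ ∧ conjSubgroup u P ≤ cent P :=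
    fun u hu => hG.exists_localFactor_conj_le_cent h0 (ne_of_mem_of_not_mem hu h1)
  choose! P hP hPb hPu using this
  -- On the open coset `u * normalizer (P u)` the conjugate of `P u` is constant, so one witness
  -- serves the whole coset.
  obtain ⟨F, hF, hCF⟩ := hC.elim_nhds_subcover
    (fun u => {x | u⁻¹ * x ∈ Subgroup.normalizer (P u : Set G)}) (fun u hu =>
      ((hP u hu).isOpen_normalizer.preimage (continuous_const_mul u⁻¹)).mem_nhds (by simp))
  refine ⟨P '' F, F.finite_toSet.image P, ?_, ?_⟩
  · rintro _ ⟨u, hu, rfl⟩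
    exact ⟨hP u (hF u hu), hPb u (hF u hu)⟩
  · intro Q hQ x hxQ hxC
    obtain ⟨u, hu, hxu⟩ := Set.mem_iUnion₂.1 (hCF hxC)
    refine ⟨P u, ⟨u, hu, rfl⟩, (hP u (hF u hu)).le_of_conj_le_cent hZ hQ hxQ ?_⟩
    have h2 := mem_normalizer_iff_conjSubgroup_eq.1 hxu
    have h3 : conjSubgroup x (P u) = conjSubgroup u (P u) := by
      conv_rhs => rw [← h2, ← conjSubgroup_mul]
      simp
    rw [h3]
    exact hPu u (hF u hu)

/-- Every nontrivial element of `U` can be conjugated within `U` out of a fixed neighbourhood. -/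
theorem exists_conj_not_mem (hG : IsInClassS G) {U : Subgroup G} (hUo : IsOpen (U : Set G))
    (hUc : IsCompact (U : Set G)) :
    ∃ V : Set G, IsOpen V ∧ (1 : G) ∈ V ∧
      ∀ k : G, k ≠ 1 → k ∈ U → ∃ g : G, g⁻¹ * k * g ∈ U ∧ g⁻¹ * k * g ∉ V := by
  have := hG.t2Space
  obtain ⟨F, hF, -, hFU⟩ := exists_finite_generate_of_dense hG.compactlyGenerated dense_univ hUo
  -- `V` is the set of elements that each generator in `F ∪ F⁻¹` conjugates into `U`. If conjugates
  -- of `k` in `U` never left `V`, induction on word length would put `k` in the normal core of `U`,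
  -- which is trivial.
  refine ⟨⋂ s ∈ F ∪ F⁻¹, {x | s⁻¹ * x * s ∈ U}, ?_, ?_, ?_⟩
  · exact (hF.union hF.inv).isOpen_biInter fun s _ => hUo.preimage (by fun_prop)
  · exact Set.mem_iInter₂.2 fun s _ => by simp
  · intro k hk1 hkU
    by_contra! h
    have step : ∀ g s : G, s ∈ F ∪ F⁻¹ → g⁻¹ * k * g ∈ U → (g * s)⁻¹ * k * (g * s) ∈ U := by
      intro g s hs hg
      have : s⁻¹ * (g⁻¹ * k * g) * s ∈ U := Set.mem_iInter₂.1 (h g hg) s hs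
      convert this using 1
      group
    have stepU : ∀ g s : G, s ∈ U → g⁻¹ * k * g ∈ U → (g * s)⁻¹ * k * (g * s) ∈ U := by
      intro g s hs hg
      have := mul_mem (mul_mem (inv_mem hs) hg) hs
      convert this using 1
      group
    have hall : ∀ g : G, g⁻¹ * k * g ∈ U := by
      intro g
      have hg : g ∈ Subgroup.closure ((U : Set G) ∪ F) := hFU ▸ Subgroup.mem_top g
      induction hg using Subgroup.closure_induction_right with
      | one => simpa using hkU
      | mul_right x y hy hx ih =>
        rcases hx with hx | hx
        · exact stepU _ _ hx ih
        · exact step _ _ (Or.inl hx) ih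
      | mul_inv_cancel x y hy hx ih =>
        rcases hx with hx | hx
        · exact stepU _ _ (inv_mem hx) ih
        · exact step _ _ (Or.inr (by simpa using hx)) ih
    have hb := hG.eq_bot_of_normal_of_le U.normalCore_normal
      (U.normalCore_isClosed (U.isClosed_of_isOpen hUo)) hUc U.normalCore_le
    have hkc : k ∈ U.normalCore := fun g => by simpa using hall g⁻¹
    rw [hb, Subgroup.mem_bot] at hkc
    exact hk1 hkc

/-- Some nontrivial element of `Q` lies in `U` and can be conjugated into the compact set `U \ V`,
which avoids the identity; `exists_finite_localFactors` applies there. -/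
theorem exists_finite_conj_le (hG : IsInClassS G) (h0 : HasNontrivialLocalFactor G) :
    ∃ S : Set (Subgroup G), S.Finite ∧ (∀ P ∈ S, IsLocalFactor P ∧ P ≠ ⊥) ∧
      ∀ Q, IsLocalFactor Q → Q ≠ ⊥ → ∃ P ∈ S, ∃ g, conjSubgroup g P ≤ Q := by
  have := hG.t2Space
  have := hG.locallyCompact
  have := hG.totallyDisconnected
  obtain ⟨U, hUo, hUc, -⟩ := exists_compact_open_subgroup (G := G) Filter.univ_mem
  obtain ⟨V, hVo, hV1, hV⟩ := hG.exists_conj_not_mem hUo hUc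
  obtain ⟨S, hS, hSP, hSQ⟩ := hG.exists_finite_localFactors h0 (hUc.diff hVo) fun h => h.2 hV1
  refine ⟨S, hS, hSP, fun Q hQ hQb => ?_⟩
  obtain ⟨k, hkQ, hkU, hk1⟩ := hQ.inf_ne_bot_of_mem_nhds hG.hasTrivialQuasiCenter hQb
    (hUo.mem_nhds (one_mem U))
  obtain ⟨g, hgU, hgV⟩ := hV k hk1 hkU
  obtain ⟨P, hP, hPQ⟩ := hSQ _ (hQ.conj g⁻¹) (g⁻¹ * k * g)
    (by simpa [mem_conjSubgroup, mul_assoc] using hkQ) ⟨hgU, hgV⟩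
  exact ⟨P, hP, g, conjSubgroup_le_iff.2 hPQ⟩

/-- Otherwise "some conjugate of `P` is strictly below `Q`" is a strict order on the finite set `S`.
A minimal element contradicts the absence of atoms. -/
theorem exists_conj_lt (hG : IsInClassS G) (h0 : HasNontrivialLocalFactor G) :
    ∃ P, IsLocalFactor P ∧ ∃ g : G, conjSubgroup g P < P := by
  obtain ⟨S, hS, hSP, hSQ⟩ := hG.exists_finite_conj_le h0
  by_contra! h
  have : Finite S := hS
  let r : S → S → Prop := fun P Q => ∃ g, conjSubgroup g (P : Subgroup G) < Q
  have hlt : ∀ {g : G} {P Q : Subgroup G}, P < Q → conjSubgroup g P < conjSubgroup g Q :=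
    fun {g P Q} hPQ => lt_of_le_of_ne (conjSubgroup_mono hPQ.le) fun e =>
      hPQ.ne (conjSubgroup_injective g e)
  have : Std.Irrefl r := ⟨fun P ⟨g, hg⟩ => h P (hSP P P.2).1 g hg⟩
  have : IsTrans S r := ⟨fun P Q R ⟨g, hg⟩ ⟨k, hk⟩ => ⟨k * g, by
    rw [conjSubgroup_mul]; exact (hlt hg).trans hk⟩⟩
  have hwf : WellFounded r := Finite.wellFounded_of_trans_of_irrefl r
  have hne : (Set.univ : Set S).Nonempty := by
    obtain ⟨R, hR, hRb, -⟩ := h0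
    obtain ⟨P, hP, -⟩ := hSQ R hR hRb
    exact ⟨⟨P, hP⟩, trivial⟩
  obtain ⟨P, -, hPmin⟩ := hwf.has_min _ hne
  obtain ⟨Q, hQ, hQb, hQP⟩ := hG.exists_localFactor_lt h0 (hSP P P.2).1 (hSP P P.2).2
  obtain ⟨P', hP', g, hg⟩ := hSQ Q hQ hQb
  exact hPmin ⟨P', hP'⟩ trivial ⟨g, hg.trans_lt hQP⟩

theorem exists_mem_conj_lt (hG : IsInClassS G) (h0 : HasNontrivialLocalFactor G)
    {N : Subgroup G} (hN : N.Normal) (hNb : N ≠ ⊥) :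
    ∃ P, IsLocalFactor P ∧ ∃ h ∈ N, conjSubgroup h P < P := by
  obtain ⟨P, hP, g, hg⟩ := hG.exists_conj_lt h0
  obtain ⟨h, hh, hhN⟩ := (hG.topologicallySimple.dense hN hNb).inter_open_nonempty
    ((g⁻¹ * ·) ⁻¹' (Subgroup.normalizer (P : Set G) : Set G))
    (hP.isOpen_normalizer.preimage (continuous_const_mul g⁻¹)) ⟨g, by simp⟩
  refine ⟨P, hP, h, hhN, ?_⟩
  have h2 : conjSubgroup (g⁻¹ * h) P = P := mem_normalizer_iff_conjSubgroup_eq.1 hh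
  have h3 : conjSubgroup h P = conjSubgroup g P := by
    conv_rhs => rw [← h2, ← conjSubgroup_mul]
    simp
  rwa [h3]

end IsInClassS

/-! ### Local factors locally contained in a normal subgroup. -/

section LocallyIn

variable {G : Type*} [Group G] [TopologicalSpace G]

/-- `P` is a local factor that is locally contained in `N`. -/
def IsLocallyIn (N P : Subgroup G) : Prop :=
  IsLocalFactor P ∧ ∃ V ∈ 𝓝 (1 : G), (P : Set G) ∩ V ⊆ N

lemma IsLocallyIn.bot (hZ : HasTrivialQuasiCenter G) (N : Subgroup G) :
    IsLocallyIn N (cent ⊤) := by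
  refine ⟨(isLocalFactor_top hZ).centralizer, _, Filter.univ_mem, ?_⟩
  rintro x ⟨hx, -⟩
  rw [(isLocalFactor_top hZ).eq_one hZ (x := x) trivial hx]
  exact one_mem N

variable [IsTopologicalGroup G]

lemma IsLocallyIn.conj {N P : Subgroup G} (hN : N.Normal) (h : IsLocallyIn N P) (g : G) :
    IsLocallyIn N (conjSubgroup g P) := by
  obtain ⟨hP, V, hV, hPV⟩ := h
  refine ⟨hP.conj g, _, conj_preimage_mem_nhds_one g⁻¹ hV, ?_⟩
  rintro x ⟨hx, hxV⟩
  have h1 : g⁻¹ * x * g ∈ N := hPV ⟨mem_conjSubgroup.1 hx, by simpa using hxV⟩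
  have h2 : g * (g⁻¹ * x * g) * g⁻¹ ∈ N := hN.conj_mem _ h1 g
  rwa [show g * (g⁻¹ * x * g) * g⁻¹ = x by group] at h2

/-- By De Morgan, `J = cent (cent P ⊓ cent Q)` is the join. Since `J ⊓ cent P ≤ Q`, elements of `J`
near the identity are products of small elements of `P` and `Q`. -/
lemma IsLocallyIn.sup (hZ : HasTrivialQuasiCenter G) {N P Q : Subgroup G} (hP : IsLocallyIn N P)
    (hQ : IsLocallyIn N Q) : IsLocallyIn N (cent (cent P ⊓ cent Q)) := by
  obtain ⟨hP, V, hV, hPV⟩ := hP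
  obtain ⟨hQ, W, hW, hQW⟩ := hQ
  have hJ := (hP.centralizer.inf hZ hQ.centralizer).centralizer
  refine ⟨hJ, _, hP.mul_mem_nhds _ (Filter.inter_mem hV hW), ?_⟩
  rintro _ ⟨hx, a, ⟨ha, haV, -⟩, b, ⟨hb, -, hbW⟩, rfl⟩
  have hPJ : P ≤ cent (cent P ⊓ cent Q) := le_cent_comm.1 inf_le_left
  have hbJ : b ∈ cent (cent P ⊓ cent Q) := by
    simpa using mul_mem (inv_mem (hPJ ha)) hx
  have hle : cent (cent P ⊓ cent Q) ⊓ cent P ≤ Q := by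
    refine (hJ.inf hZ hP.centralizer).le_of_inf_cent_eq_bot hZ hQ ?_
    rw [inf_assoc, inf_comm]
    exact (hP.centralizer.inf hZ hQ.centralizer).inf_cent hZ
  exact mul_mem (hPV ⟨ha, haV⟩) (hQW ⟨hle ⟨hbJ, hb⟩, hbW⟩)

lemma IsLocallyIn.finite_sup (hZ : HasTrivialQuasiCenter G) {N : Subgroup G}
    {S : Set (Subgroup G)} (hS : S.Finite) (h : ∀ P ∈ S, IsLocallyIn N P) :
    IsLocallyIn N (cent (⨅ P ∈ S, cent P)) := by
  have key : IsLocalFactor (⨅ P ∈ S, cent P) ∧ IsLocallyIn N (cent (⨅ P ∈ S, cent P)) := by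
    induction S, hS using Set.Finite.induction_on with
    | empty => simpa using ⟨isLocalFactor_top hZ, IsLocallyIn.bot hZ N⟩
    | @insert P S _ _ ih =>
      obtain ⟨h1, h2⟩ := ih fun Q hQ => h Q (Set.mem_insert_of_mem _ hQ)
      have hP := h P (Set.mem_insert _ _)
      rw [iInf_insert]
      refine ⟨hP.1.centralizer.inf hZ h1, ?_⟩
      have := hP.sup hZ h2
      rwa [h1.cent_cent] at this
  exact key.2

end LocallyIn

/-! ### Contraction into normal subgroups, and abstract simplicity. -/

namespace IsInClassS

variable {G : Type*} [Group G] [TopologicalSpace G] [IsTopologicalGroup G]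

/-- Pairwise disjoint local factors shrink to the identity inside a compact subgroup. -/
theorem exists_forall_ge_subset (hG : IsInClassS G) (h0 : HasNontrivialLocalFactor G)
    {D : ℕ → Subgroup G} (hD : ∀ n, IsLocalFactor (D n))
    (hdisj : ∀ m n, m < n → D m ⊓ D n = ⊥)
    {C W : Set G} (hC : IsCompact C) (hW : W ∈ 𝓝 (1 : G)) :
    ∃ n₀, ∀ n ≥ n₀, ∀ x ∈ D n, x ∈ C → x ∈ W := by
  obtain ⟨W', hW', hW'o, h1⟩ := mem_nhds_iff.1 hW
  obtain ⟨S, hS, hSP, hSQ⟩ := hG.exists_finite_localFactors h0 (hC.diff hW'o) fun h => h.2 h1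
  -- By disjointness each nontrivial `P ∈ S` lies in at most one `D n`, while a `D n` meeting `C \
  -- W'` must contain some member of `S`.
  have hfin : {n | ∃ P ∈ S, P ≤ D n}.Finite := by
    have : {n | ∃ P ∈ S, P ≤ D n} = ⋃ P ∈ S, {n | P ≤ D n} := by ext n; simp
    rw [this]
    refine hS.biUnion fun P hP => Set.Subsingleton.finite fun m hm n hn => ?_
    by_contra hmn
    rcases lt_or_gt_of_ne hmn with h | h
    · exact (hSP P hP).2 (le_bot_iff.1 ((le_inf hm hn).trans (hdisj _ _ h).le))
    · exact (hSP P hP).2 (le_bot_iff.1 ((le_inf hn hm).trans (hdisj _ _ h).le))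
  obtain ⟨N, hN⟩ := hfin.bddAbove
  refine ⟨N + 1, fun n hn x hx hxC => ?_⟩
  by_contra hxW
  obtain ⟨P, hP, hPn⟩ := hSQ _ (hD n) x hx ⟨hxC, fun h => hxW (hW' h)⟩
  have := hN ⟨P, hP, hPn⟩
  omega

/-- An element contracted by `h` while staying in a compact subgroup is a commutator with `h`. -/
theorem mem_of_tendsto_conj [T2Space G] {N : Subgroup G} (hN : N.Normal) {h x : G} (hh : h ∈ N)
    {U : Subgroup G} (hU : IsCompact (U : Set G)) (hx : ∀ n : ℕ, h ^ n * x * (h ^ n)⁻¹ ∈ U)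
    (hlim : Filter.Tendsto (fun n : ℕ => h ^ n * x * (h ^ n)⁻¹) Filter.atTop (𝓝 1)) :
    x ∈ N := by
  -- `y n` is the product of `hⁱxh⁻ⁱ` for `i < n`. A cluster point `z` satisfies `x * (h * z * h⁻¹)
  -- = z`, so `x = z * h * z⁻¹ * h⁻¹`. An ultrafilter supplies `z`, as compactness alone does not
  -- make `y` converge.
  let y : ℕ → G := fun n => Nat.rec 1 (fun n z => z * (h ^ n * x * (h ^ n)⁻¹)) n
  have hysucc : ∀ n, y (n + 1) = y n * (h ^ n * x * (h ^ n)⁻¹) := fun n => rfl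
  have hyU : ∀ n, y n ∈ U := by
    intro n
    induction n with
    | zero => exact one_mem U
    | succ n ih => rw [hysucc]; exact mul_mem ih (hx n)
  have hyh : ∀ n, x * (h * y n * h⁻¹) = y (n + 1) := by
    intro n
    induction n with
    | zero => simp [y]
    | succ n ih =>
      calc x * (h * y (n + 1) * h⁻¹)
          = x * (h * y n * h⁻¹) * (h * (h ^ n * x * (h ^ n)⁻¹) * h⁻¹) := by rw [hysucc n]; group
        _ = y (n + 1) * (h ^ (n + 1) * x * (h ^ (n + 1))⁻¹) := by
          rw [ih, pow_succ', mul_inv_rev]; simp only [mul_assoc]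
  let F : Ultrafilter ℕ := Ultrafilter.of Filter.atTop
  have hF : (F : Filter ℕ) ≤ Filter.atTop := Ultrafilter.of_le _
  obtain ⟨z, -, hz⟩ := hU.ultrafilter_le_nhds (F.map y)
    (Filter.le_principal_iff.2 (Filter.Eventually.of_forall (p := fun n => y n ∈ U) hyU))
  have hz' : Filter.Tendsto y F (𝓝 z) := hz
  have l1 : Filter.Tendsto (fun n => x * (h * y n * h⁻¹)) F (𝓝 (x * (h * z * h⁻¹))) :=
    ((hz'.const_mul h).mul_const h⁻¹).const_mul x
  have l2 : Filter.Tendsto (fun n => y n * (h ^ n * x * (h ^ n)⁻¹)) F (𝓝 (z * 1)) :=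
    hz'.mul (hlim.mono_left hF)
  have he : x * (h * z * h⁻¹) = z * 1 :=
    tendsto_nhds_unique l1 (l2.congr fun n => by rw [hyh, hysucc])
  have hxe : x = (z * h * z⁻¹) * h⁻¹ := by
    rw [mul_one] at he
    rw [eq_mul_inv_of_mul_eq he]; group
  rw [hxe]
  exact mul_mem (hN.conj_mem h hh z) (inv_mem hh)

theorem exists_localFactor_inter_subset (hG : IsInClassS G) (h0 : HasNontrivialLocalFactor G)
    {N : Subgroup G} (hN : N.Normal) (hNb : N ≠ ⊥) :
    ∃ P : Subgroup G, IsLocalFactor P ∧ P ≠ ⊥ ∧ ∃ V ∈ 𝓝 (1 : G), (P : Set G) ∩ V ⊆ N := by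
  have hZ := hG.hasTrivialQuasiCenter
  have := hG.t2Space
  have := hG.locallyCompact
  have := hG.totallyDisconnected
  obtain ⟨P, hP, h, hhN, hlt⟩ := hG.exists_mem_conj_lt h0 hN hNb
  have hPh := hP.conj h
  have hanti : Antitone fun n : ℕ => conjSubgroup (h ^ n) P := antitone_nat_of_succ_le fun n => by
    rw [pow_succ, conjSubgroup_mul]
    exact conjSubgroup_mono hlt.le
  let D : ℕ → Subgroup G := fun n => conjSubgroup (h ^ n) (P ⊓ cent (conjSubgroup h P))
  have hD : ∀ n, IsLocalFactor (D n) := fun n => (hP.inf hZ hPh.centralizer).conj _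
  have hDb : ∀ n, D n ≠ ⊥ := fun n => conjSubgroup_ne_bot fun hb =>
    hlt.not_ge (hP.le_of_inf_cent_eq_bot hZ hPh hb)
  have hDsucc : ∀ n x, x ∈ D n ↔ h * x * h⁻¹ ∈ D (n + 1) := by
    intro n x
    simp only [D, mem_conjSubgroup]
    rw [show (h ^ (n + 1))⁻¹ * (h * x * h⁻¹) * h ^ (n + 1) = (h ^ n)⁻¹ * x * h ^ n by
      rw [pow_succ']; group]
  have hdisj : ∀ m n, m < n → D m ⊓ D n = ⊥ := by
    intro m n hmn
    refine (hP.conj (h ^ (m + 1))).eq_bot_of_le_cent hZ (inf_le_right.trans ?_)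
      (inf_le_left.trans ?_)
    · exact (conjSubgroup_mono inf_le_left).trans (hanti hmn)
    · rw [pow_succ, conjSubgroup_mul, cent_conjSubgroup (h ^ m)]
      exact conjSubgroup_mono inf_le_right
  obtain ⟨U, hUo, hUc, -⟩ := exists_compact_open_subgroup (G := G) Filter.univ_mem
  -- From `n₀` on, conjugation by `h` keeps `D n ∩ U` inside `U`, so whole forward orbits stay in
  -- `U`.
  obtain ⟨n₀, hn₀⟩ := hG.exists_forall_ge_subset h0 hD hdisj hUc
    (conj_preimage_mem_nhds_one h (hUo.mem_nhds (one_mem U)))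
  refine ⟨D n₀, hD n₀, hDb n₀, U, hUo.mem_nhds (one_mem U), ?_⟩
  rintro x ⟨hx, hxU⟩
  have hstay : ∀ n : ℕ, h ^ n * x * (h ^ n)⁻¹ ∈ D (n₀ + n) ∧ h ^ n * x * (h ^ n)⁻¹ ∈ U := by
    intro n
    induction n with
    | zero => simpa using ⟨hx, hxU⟩
    | succ n ih =>
      have e : h ^ (n + 1) * x * (h ^ (n + 1))⁻¹ = h * (h ^ n * x * (h ^ n)⁻¹) * h⁻¹ := by
        rw [pow_succ']; group
      rw [e]
      exact ⟨(hDsucc _ _).1 ih.1, hn₀ _ (Nat.le_add_right _ _) _ ih.1 ih.2⟩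
  refine mem_of_tendsto_conj hN hhN hUc (fun n => (hstay n).2) ?_
  intro W hW
  obtain ⟨n₁, hn₁⟩ := hG.exists_forall_ge_subset h0 hD hdisj hUc hW
  refine Filter.mem_map.2 (Filter.mem_atTop_sets.2 ⟨n₁, fun n hn => ?_⟩)
  exact hn₁ _ (hn.trans (Nat.le_add_left _ _)) _ (hstay n).1 (hstay n).2

/-- Factors locally in `N` sweep out a dense normal subgroup, so `U` and finitely many elements of
such factors generate `G`. Open normalizers make the `U`-orbits of these factors finite; the join of
the orbits is normalized by `U` and contains the other generators, so it is normal and closed, hence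
`G`. -/
theorem isLocallyIn_top (hG : IsInClassS G) {N P : Subgroup G} (hN : N.Normal)
    (hP : IsLocallyIn N P) (hb : P ≠ ⊥) : IsLocallyIn N ⊤ := by
  have hZ := hG.hasTrivialQuasiCenter
  have := hG.t2Space
  have := hG.locallyCompact
  have := hG.totallyDisconnected
  obtain ⟨U, hUo, hUc, -⟩ := exists_compact_open_subgroup (G := G) Filter.univ_mem
  -- the normal subgroup swept out by all local factors locally contained in `N`
  let M : Subgroup G := Subgroup.closure {x | ∃ Q, IsLocallyIn N Q ∧ x ∈ Q}
  have hM : ∀ x ∈ M, ∃ Q, IsLocallyIn N Q ∧ x ∈ Q := by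
    intro x hx
    induction hx using Subgroup.closure_induction with
    | mem x hx => exact hx
    | one => exact ⟨P, hP, one_mem P⟩
    | mul x y _ _ hx hy =>
      obtain ⟨Q, hQ, hxQ⟩ := hx
      obtain ⟨R, hR, hyR⟩ := hy
      exact ⟨_, hQ.sup hZ hR, mul_mem (le_cent_comm.1 inf_le_left hxQ)
        (le_cent_comm.1 inf_le_right hyR)⟩
    | inv x _ hx =>
      obtain ⟨Q, hQ, hxQ⟩ := hx
      exact ⟨Q, hQ, inv_mem hxQ⟩
  have hMn : M.Normal := ⟨fun x hx g => by
    obtain ⟨Q, hQ, hxQ⟩ := hM x hx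
    exact Subgroup.subset_closure ⟨_, hQ.conj hN g, conj_mem_conjSubgroup hxQ⟩⟩
  have hPM : P ≤ M := fun x hx => Subgroup.subset_closure ⟨P, hP, hx⟩
  have hMb : M ≠ ⊥ := fun h => hb (le_bot_iff.1 (hPM.trans h.le))
  obtain ⟨F, hF, hFM, hFU⟩ := exists_finite_generate_of_dense hG.compactlyGenerated
    (hG.topologicallySimple.dense hMn hMb) hUo
  choose! Q hQ hFQ using fun x (hx : x ∈ F) => hM x (hFM hx)
  -- Including `P` keeps the join nontrivial even if `F` is empty.
  let S : Set (Subgroup G) :=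
    (fun p : G × Subgroup G => conjSubgroup p.1 p.2) '' ((U : Set G) ×ˢ insert P (Q '' F))
  have hSN : ∀ R ∈ S, IsLocallyIn N R := by
    rintro _ ⟨⟨u, R⟩, ⟨-, rfl | ⟨x, hx, rfl⟩⟩, rfl⟩
    · exact hP.conj hN u
    · exact (hQ x hx).conj hN u
  have horb : ∀ R, IsLocalFactor R → ((fun u => conjSubgroup u R) '' (U : Set G)).Finite := by
    intro R hR
    obtain ⟨T, hT, hUT⟩ := hUc.elim_nhds_subcover
      (fun u => {x | u⁻¹ * x ∈ Subgroup.normalizer (R : Set G)}) (fun u _ =>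
        (hR.isOpen_normalizer.preimage (continuous_const_mul u⁻¹)).mem_nhds (by simp))
    refine (T.finite_toSet.image fun u => conjSubgroup u R).subset ?_
    rintro _ ⟨u, hu, rfl⟩
    obtain ⟨t, ht, htu⟩ := Set.mem_iUnion₂.1 (hUT hu)
    refine ⟨t, ht, ?_⟩
    have h2 : conjSubgroup (t⁻¹ * u) R = R := mem_normalizer_iff_conjSubgroup_eq.1 htu
    change conjSubgroup t R = conjSubgroup u R
    conv_lhs => rw [← h2, ← conjSubgroup_mul]
    simp
  have hSfin : S.Finite := by
    have : S = ⋃ R ∈ insert P (Q '' F), (fun u => conjSubgroup u R) '' (U : Set G) := by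
      ext R
      simp only [S, Set.mem_image, Set.mem_prod, Prod.exists, Set.mem_iUnion, exists_prop]
      constructor
      · rintro ⟨u, R', ⟨hu, hR'⟩, rfl⟩; exact ⟨R', hR', u, hu, rfl⟩
      · rintro ⟨R', hR', u, hu, rfl⟩; exact ⟨u, R', ⟨hu, hR'⟩, rfl⟩
    rw [this]
    refine ((hF.image Q).insert P).biUnion ?_
    rintro R (rfl | ⟨x, hx, rfl⟩)
    · exact horb _ hP.1
    · exact horb _ (hQ x hx).1
  have hSconj : ∀ u ∈ U, ∀ R ∈ S, conjSubgroup u R ∈ S := by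
    rintro u hu _ ⟨⟨v, R⟩, ⟨hv, hR⟩, rfl⟩
    exact ⟨⟨u * v, R⟩, ⟨mul_mem hu hv, hR⟩, conjSubgroup_mul _ _ _⟩
  have hJ := IsLocallyIn.finite_sup hZ hSfin hSN
  set J := cent (⨅ R ∈ S, cent R) with hJdef
  have hSJ : ∀ R ∈ S, R ≤ J := fun R hR => le_cent_comm.1 (iInf₂_le R hR)
  have hSelf : ∀ R ∈ insert P (Q '' F), R ∈ S := fun R hR =>
    ⟨⟨1, R⟩, ⟨one_mem U, hR⟩, conjSubgroup_one R⟩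
  have hUinf : ∀ u ∈ U, (⨅ R ∈ S, cent R) ≤ conjSubgroup u (⨅ R ∈ S, cent R) := by
    intro u hu
    rw [← inv_inv u, ← conjSubgroup_le_iff]
    refine le_iInf₂ fun R hR => ?_
    rw [conjSubgroup_le_iff, inv_inv, ← cent_conjSubgroup]
    exact iInf₂_le _ (hSconj u hu R hR)
  have hUeq : ∀ u ∈ U, conjSubgroup u (⨅ R ∈ S, cent R) = ⨅ R ∈ S, cent R := by
    intro u hu
    refine le_antisymm ?_ (hUinf u hu)
    rw [conjSubgroup_le_iff]
    exact hUinf u⁻¹ (inv_mem hu)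
  have hJn : J.Normal := by
    refine Subgroup.normal_of_closure_eq_top J hFU (Set.union_subset (fun u hu => ?_) fun x hx => ?_)
    · refine mem_normalizer_iff_conjSubgroup_eq.2 ?_
      rw [hJdef, ← cent_conjSubgroup, hUeq u hu]
    · exact Subgroup.le_normalizer (hSJ _ (hSelf _ (Or.inr ⟨x, hx, rfl⟩)) (hFQ x hx))
  have hJb : J ≠ ⊥ := fun h =>
    hb (le_bot_iff.1 ((hSJ P (hSelf P (Or.inl rfl))).trans h.le))
  rwa [(hG.topologicallySimple.eq_bot_or_eq_top J hJn hJ.1.isClosed).resolve_left hJb] at hJ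

theorem isSimpleGroup (hG : IsInClassS G) (h0 : HasNontrivialLocalFactor G) : IsSimpleGroup G where
  exists_pair_ne := hG.topologicallySimple.nontrivial.exists_pair_ne
  eq_bot_or_eq_top_of_normal N hN := by
    refine or_iff_not_imp_left.2 fun hb => ?_
    obtain ⟨P, hP, hPb, hPN⟩ := hG.exists_localFactor_inter_subset h0 hN hb
    obtain ⟨-, V, hV, hVN⟩ := hG.isLocallyIn_top hN ⟨hP, hPN⟩ hPb
    refine hG.topologicallySimple.eq_top_of_isOpen hN hb le_rfl (N.isOpen_of_mem_nhds (g := 1) ?_)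
    exact Filter.mem_of_superset hV fun x hx => hVN ⟨trivial, hx⟩

end IsInClassS

theorem mainTheorem7 (G : Type*) [Group G] [TopologicalSpace G] [IsTopologicalGroup G]
    (hG : IsInClassS G)
    (hdec : ∃ O : Subgroup G, IsOpen (O : Set G) ∧ HasNontrivialClosedDecomposition O) :
    IsSimpleGroup G := by
  have := hG.t2Space
  have := hG.locallyCompact
  have := isSigmaCompact_of_compactlyGenerated hG.compactlyGenerated
  obtain ⟨O, hO, A, B, hA, hB, hAb, hBb, hAB⟩ := hdec
  exact hG.isSimpleGroup ((hAB.isLocalFactorPair hO hA hB).hasNontrivialLocalFactor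
    hG.hasTrivialQuasiCenter hAb hBb)
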